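/- **Proposition 4.1.** All Euclidean spaces carry the Euclidean distance. A *gauge function* is a continuous nondecreasing function $g:[0,\infty)\to[0,\infty)$ with $g(0)=0$ and $g(t)>0$ for $t>0$. The Hausdorff measure of a set $E$ is $\mathcal H^g(E)=\lim_{\delta\to0}\inf\{\sum_i g(\operatorname{diam}E_i) : E\subset\bigcup_i E_i,\ \operatorname{diam}E_i<\delta\}$, the infimum being over countable covers, and $\mathcal H^n$ is the $n$-dimensional Hausdorff measure, i.e. the case $g(t)=t^n$. For a map $h:X\to\mathbb R^m$ on a metric space $(X,d)$ let $$l_h(x)=\liminf_{r\to0^+}\frac{\sup_{d(x,y)\le r}\|h(y)-h(x)\|}{r}\in[0,\infty].$$ For $E\subset\mathbb R^m$ and $x\in E$, the *contingent* of $E$ at $x$ is the set of all half-lines $L$ issuing from $x$ for which there are points $y_k\in E\setminus\{x\}$ with $y_k\to x$ such that the half-lines from $x$ through $y_k$ converge to $L$ (that is, their unit direction vectors converge to that of $L$). A set $E$ homeomorphic to $[0,1]^n$ has a *tangent plane* at $x\in E$ if the union of the half-lines in its contingent at $x$ is an $n$-dimensional affine plane. (1) For every integer $n>1$ there is a set $S\subset\mathbb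 R^{n+1}$ homeomorphic to $[0,1]^n$ such that $\mathcal H^n(S)<\infty$ and $S$ has no tangent plane at any of its points. (2) For every integer $n\ge1$ and every gauge function $g$ there are a set $S\subset\mathbb R^{n+1}$ and a homeomorphism $h:[0,1]^n\to S$ such that $l_h(x)<\infty$ for every $x\in[0,1]^n$ outside a set of zero $\mathcal H^g$ measure, and $h$ is not differentiable at any point of $[0,1]^n$ (at boundary points, differentiability is understood relative to $[0,1]^n$). -/

import Mathlib

open Set Filter Topology MeasureTheory
open scoped NNReal ENNReal

/-- The closed unit cube `[0,1]^n` in Euclidean space `ℝ^n`. -/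
def unitCube (n : ℕ) : Set (EuclideanSpace ℝ (Fin n)) :=
  {x | ∀ i, x i ∈ Icc (0 : ℝ) 1}

/-- Gauge functions `g : [0,∞) → [0,∞)`. -/
structure IsGauge (g : ℝ≥0 → ℝ≥0) : Prop where
  continuous : Continuous g
  monotone : Monotone g
  map_zero : g 0 = 0
  pos : ∀ t, 0 < t → 0 < g t

/-- The Hausdorff measure `ℋ^g`: the limit as `δ → 0` of the infimum of `∑ g (diam Eᵢ)` over
countable covers by sets of diameter at most `δ`. The value at infinite diameter is immaterial, as
only covers of small diameter matter in the limit. -/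
noncomputable def gaugeMeasure {X : Type*} [EMetricSpace X] [MeasurableSpace X] [BorelSpace X]
    (g : ℝ≥0 → ℝ≥0) : Measure X :=
  Measure.mkMetric (fun d : ℝ≥0∞ => if d = ∞ then ∞ else (g d.toNNReal : ℝ≥0∞))

/-- The lower scaled oscillation
`l_f(x) = liminf_{r → 0+} (sup_{d(x,y) ≤ r} ‖f y - f x‖) / r`, with values in `[0,∞]`. -/
noncomputable def lowerScaledOscillation {X F : Type*} [MetricSpace X] [NormedAddCommGroup F]
    (f : X → F) (x : X) : ℝ≥0∞ :=
  liminf (fun r : ℝ => (⨆ y ∈ Metric.closedBall x r, ‖f y - f x‖ₑ) / ENNReal.ofReal r) (𝓝[>] 0)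

section Contingent

variable {V : Type*} [NormedAddCommGroup V] [NormedSpace ℝ V]

/-- The half-line issuing from `x` in the direction `u`. -/
def halfLine (x u : V) : Set V := {z | ∃ t : ℝ, 0 ≤ t ∧ z = x + t • u}

/-- The contingent of `E` at `x`: all half-lines issuing from `x` that are limits of half-lines
from `x` through points `y k ∈ E`, `y k ≠ x`, `y k → x`. Half-lines issuing from `x` converge
when their unit directions do. -/
def contingent (E : Set V) (x : V) : Set (Set V) :=
  {L | ∃ u : V, ‖u‖ = 1 ∧ L = halfLine x u ∧
    ∃ y : ℕ → V, (∀ k, y k ∈ E ∧ y k ≠ x) ∧ Tendsto y atTop (𝓝 x) ∧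
      Tendsto (fun k => ‖y k - x‖⁻¹ • (y k - x)) atTop (𝓝 u)}

/-- `E` has a `k`-dimensional tangent plane at `x`: the half-lines of its contingent at `x`
together make up a `k`-dimensional (affine) plane through `x`. -/
def HasTangentPlaneAt (k : ℕ) (E : Set V) (x : V) : Prop :=
  ∃ P : AffineSubspace ℝ V, x ∈ P ∧ Module.finrank ℝ P.direction = k ∧
    ⋃₀ contingent E x = (P : Set V)

end Contingent

/-! Both examples are graphs over the cube of a limit f of functions F_k, with F_0 = 0, obtained by
adding ever narrower spikes. Step k puts spikes of radius ε_k at each anchor a of a grid of mesh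
2p_k and at the n points a + p_k e_j. All n + 1 spikes of an anchor sweep the same interval [b -
η_k, b + η_k]. Since p_k ≤ η_k, ε_k ≤ 2^(-k) p_k, and all later steps together change values by at
most ε_k, the graph at scale p_k around any of its points contains, up to o(p_k), points whose
differences are p_k e_1, ..., p_k e_n and ±p_k times the vertical vector. Hence no nonzero linear
form is negligible along the graph (`eq_zero_of_isLittleO`), which rules out both a tangent plane
and a derivative.

The radius ε_k is chosen after the number of spikes is known, so card P_k · ψ(ε_k) ≤ 2^(-k) can be
imposed for any ψ tending to 0.

For (1), ψ(e) = e^(n-1), where n > 1 is needed. The sides of a spike have measure of order η_k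
ε_k^(n-1), which is summable over all spikes. The rest of the graph lies in the flat base or above
infinitely many spikes, and the latter part is null by a Borel–Cantelli argument.

For (2), ψ(e) is g at a multiple of e. The points in infinitely many doubled spike balls form an
`ℋ^g`-null set. At any other point, f is within ε_k of one fixed Lipschitz function on the ball of
radius ε_k, for all large k, and these radii bound the lower limit. -/

/-- The function `F`, modified near `q` so as to run through the whole interval `[c - η, c + η]`. -/
noncomputable def spike {E : Type*} [NormedAddCommGroup E] (F : E → ℝ) (η K : ℝ) (z : E × ℝ)
    (y : E) : ℝ :=
  max (z.2 + η - K * ‖y - z.1‖) (min (F y) (z.2 - 3 * η + K * ‖y - z.1‖))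

/-! ### A single spike. -/

section Spike

variable {E : Type*} [NormedAddCommGroup E] {F : E → ℝ} {η K : ℝ} {z : E × ℝ} {y : E}

/-- The two cones cross at height `z.2 - η`, where `K * ‖y - z.1‖ = 2 * η`: where the
upward-pointing one has fallen below that level, the other has risen above it. -/
theorem abs_spike_sub_le (hK : 0 ≤ K) (hF : |F y - z.2| ≤ η) :
    |spike F η K z y - z.2| ≤ η := by
  have h1 : 0 ≤ K * ‖y - z.1‖ := by positivity
  rw [abs_le] at hF ⊢
  unfold spike
  constructor
  · rcases le_total (K * ‖y - z.1‖) (2 * η) with h | h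
    · linarith [le_max_left (z.2 + η - K * ‖y - z.1‖) (min (F y) (z.2 - 3 * η + K * ‖y - z.1‖))]
    · have : z.2 - η ≤ min (F y) (z.2 - 3 * η + K * ‖y - z.1‖) :=
        le_min (by linarith) (by linarith)
      linarith [le_max_right (z.2 + η - K * ‖y - z.1‖) (min (F y) (z.2 - 3 * η + K * ‖y - z.1‖))]
  · have : max (z.2 + η - K * ‖y - z.1‖) (min (F y) (z.2 - 3 * η + K * ‖y - z.1‖)) ≤ z.2 + η :=
      max_le (by linarith) ((min_le_left _ _).trans (by linarith))
    linarith

theorem spike_eq_self (hη : 0 ≤ η) (hF : |F y - z.2| ≤ K * ‖y - z.1‖ - 3 * η) :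
    spike F η K z y = F y := by
  rw [abs_le] at hF
  unfold spike
  rw [min_eq_left (by linarith), max_eq_right (by linarith)]

/-- In this inner region the value descends from `z.2 + η` to `z.2 - η`, so the full interval is
swept. -/
theorem spike_eq_of_le (h : K * ‖y - z.1‖ ≤ 2 * η) :
    spike F η K z y = z.2 + η - K * ‖y - z.1‖ := by
  unfold spike
  exact max_eq_left ((min_le_right _ _).trans (by linarith))

/-- The new part of a graph lies on two explicit cones, which makes its measure computable. -/
theorem spike_cases : spike F η K z y = F y ∨ spike F η K z y = z.2 + η - K * ‖y - z.1‖ ∨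
    spike F η K z y = z.2 - 3 * η + K * ‖y - z.1‖ := by
  unfold spike
  rcases max_choice (z.2 + η - K * ‖y - z.1‖) (min (F y) (z.2 - 3 * η + K * ‖y - z.1‖)) with h | h
  · exact Or.inr (Or.inl h)
  · rcases min_choice (F y) (z.2 - 3 * η + K * ‖y - z.1‖) with h' | h'
    · exact Or.inl (h.trans h')
    · exact Or.inr (Or.inr (h.trans h'))

theorem exists_lipschitzWith_spike {L : ℝ≥0} (hF : LipschitzWith L F) (η K : ℝ) (z : E × ℝ) :
    ∃ L', LipschitzWith L' (spike F η K z) := by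
  have h0 : LipschitzWith ‖K‖₊ fun y : E => K * ‖y - z.1‖ := by
    apply LipschitzWith.of_dist_le_mul
    intro a b
    rw [Real.dist_eq, ← mul_sub, abs_mul, dist_eq_norm]
    refine mul_le_mul_of_nonneg_left ?_ (abs_nonneg _)
    simpa using abs_norm_sub_norm_le (a - z.1) (b - z.1)
  have h1 := (LipschitzWith.const (α := E) (z.2 + η)).sub h0
  have h2 := (LipschitzWith.const (α := E) (z.2 - 3 * η)).add h0
  exact ⟨_, h1.max (hF.min h2)⟩

end Spike

/-! ### One step of the construction. -/

/-- `F'` arises from `F` by adding spikes of height comparable to `η` in the balls of radius `ε`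
around the centers recorded in `P`. -/
structure IsSpiking {n : ℕ} (F F' : (Fin n → ℝ) → ℝ) (η p ε : ℝ)
    (P : Finset ((Fin n → ℝ) × ℝ)) : Prop where
  lipschitz : ∃ L, LipschitzWith L F'
  dist_le : ∀ y, |F' y - F y| ≤ 2 * η
  eq_of_far : ∀ y, (∀ z ∈ P, ε ≤ ‖y - z.1‖) → F' y = F y
  cases : ∀ y, F' y = F y ∨ ∃ z ∈ P, ‖y - z.1‖ ≤ ε ∧
    (F' y = z.2 + η - 4 * η / ε * ‖y - z.1‖ ∨ F' y = z.2 - 3 * η + 4 * η / ε * ‖y - z.1‖)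
  near : ∀ y, ∀ z ∈ P, ‖y - z.1‖ < ε → |F' y - z.2| ≤ η
  attains : ∀ x ∈ Icc (0 : Fin n → ℝ) 1, ∃ (a : Fin n → ℝ) (b : ℝ), ‖x - a‖ ≤ 2 * p ∧
    |F' x - b| ≤ η ∧ ∀ o : Option (Fin n), ∀ t, |t - b| ≤ η → ∃ y ∈ Icc (0 : Fin n → ℝ) 1,
      ‖y - (a + p • o.elim 0 (fun j => Pi.single j 1))‖ ≤ ε ∧ F' y = t

/-- The balls are disjoint and each spike agrees with `F` outside its ball, so the modifications can
be summed without interaction. -/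
theorem IsSpiking.of_spikes {n : ℕ} (hn : 0 < n) {F : (Fin n → ℝ) → ℝ} {L : ℝ≥0}
    (hF : LipschitzWith L F) {η p ε : ℝ} {P : Finset ((Fin n → ℝ) × ℝ)} (hη : 0 < η) (hε : 0 < ε)
    (hP : ∀ z ∈ P, ∀ z' ∈ P, z ≠ z' → 2 * ε < ‖z.1 - z'.1‖)
    (hFP : ∀ z ∈ P, |F z.1 - z.2| ≤ η / 2) (hL : L * ε ≤ η / 2)
    (hcube : ∀ z ∈ P, ∀ y, ‖y - z.1‖ ≤ ε → y ∈ Icc (0 : Fin n → ℝ) 1)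
    (hatt : ∀ x ∈ Icc (0 : Fin n → ℝ) 1, ∃ (a : Fin n → ℝ) (b : ℝ), ‖x - a‖ ≤ 2 * p ∧
      |F x - b| ≤ η ∧
      ∀ o : Option (Fin n), (a + p • o.elim 0 (fun j => Pi.single j 1), b) ∈ P)
    (hatt' : ∀ x, ∀ z ∈ P, ‖x - z.1‖ < ε → ∃ a : Fin n → ℝ, ‖x - a‖ ≤ 2 * p ∧
      ∀ o : Option (Fin n), (a + p • o.elim 0 (fun j => Pi.single j 1), z.2) ∈ P) :
    ∃ F', IsSpiking F F' η p ε P := by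
  classical
  set K := 4 * η / ε with hKdef
  have hK : 0 < K := by positivity
  have hKε : K * ε = 4 * η := by rw [hKdef]; field_simp
  have hclose : ∀ z ∈ P, ∀ y, ‖y - z.1‖ ≤ ε → |F y - z.2| ≤ η := by
    intro z hz y hy
    have h1 := hF.dist_le_mul y z.1
    rw [Real.dist_eq, dist_eq_norm] at h1
    have h2 : (L : ℝ) * ‖y - z.1‖ ≤ L * ε := by gcongr
    have := abs_sub_le (F y) (F z.1) z.2
    linarith [hFP z hz]
  have hself : ∀ z ∈ P, ∀ y, ε ≤ ‖y - z.1‖ → spike F η K z y = F y := by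
    intro z hz y hy
    apply spike_eq_self hη.le
    have h1 := hF.dist_le_mul y z.1
    rw [Real.dist_eq, dist_eq_norm] at h1
    have := abs_sub_le (F y) (F z.1) z.2
    have hLK : (L : ℝ) ≤ K := by
      rw [hKdef, le_div_iff₀ hε]; linarith
    have h3 : (K - L) * ε ≤ (K - L) * ‖y - z.1‖ := by
      apply mul_le_mul_of_nonneg_left hy; linarith
    linarith [hFP z hz]
  set F' : (Fin n → ℝ) → ℝ := fun y => F y + ∑ z ∈ P, (spike F η K z y - F y) with hF'
  have hfar : ∀ y, (∀ z ∈ P, ε ≤ ‖y - z.1‖) → F' y = F y := by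
    intro y hy
    simp only [hF']
    rw [Finset.sum_eq_zero, add_zero]
    intro z hz
    rw [hself z hz y (hy z hz), sub_self]
  have hnear : ∀ y, ∀ z ∈ P, ‖y - z.1‖ < ε → F' y = spike F η K z y := by
    intro y z hz hy
    simp only [hF']
    rw [Finset.sum_eq_single z]
    · ring
    · intro z' hz' hne
      rw [hself z' hz' y, sub_self]
      have h1 := hP z hz z' hz' hne.symm
      have h2 := norm_sub_le_norm_sub_add_norm_sub z.1 y z'.1
      rw [norm_sub_rev z.1 y] at h2
      linarith
    · intro h; exact absurd hz h
  have hdich : ∀ y, F' y = F y ∨ ∃ z ∈ P, ‖y - z.1‖ < ε ∧ F' y = spike F η K z y := by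
    intro y
    by_cases h : ∀ z ∈ P, ε ≤ ‖y - z.1‖
    · exact Or.inl (hfar y h)
    · push Not at h
      obtain ⟨z, hz, hy⟩ := h
      exact Or.inr ⟨z, hz, hy, hnear y z hz hy⟩
  have hval : ∀ z ∈ P, ∀ t, |t - z.2| ≤ η →
      ∃ y ∈ Icc (0 : Fin n → ℝ) 1, ‖y - z.1‖ ≤ ε ∧ F' y = t := by
    intro z hz t ht
    rw [abs_le] at ht
    -- The radius at which the inner cone has height `t`; it is at most ε/2. The point is taken on
    -- the diagonal, where the sup norm is ρ.
    set ρ := (z.2 + η - t) / K with hρ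
    have hρ0 : 0 ≤ ρ := div_nonneg (by linarith) hK.le
    have hKρ : K * ρ = z.2 + η - t := by rw [hρ]; field_simp
    have hρε : ρ < ε := by
      refine lt_of_mul_lt_mul_left ?_ hK.le
      rw [hKρ, hKε]; linarith
    have : Nonempty (Fin n) := ⟨⟨0, hn⟩⟩
    have hnorm : ‖z.1 + (fun _ => ρ) - z.1‖ = ρ := by
      rw [add_sub_cancel_left, pi_norm_const, Real.norm_of_nonneg hρ0]
    refine ⟨z.1 + fun _ => ρ, hcube z hz _ (by rw [hnorm]; exact hρε.le),
      by rw [hnorm]; exact hρε.le, ?_⟩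
    rw [hnear _ z hz (by rw [hnorm]; exact hρε),
      spike_eq_of_le (by rw [hnorm, hKρ]; linarith), hnorm, hKρ]
    ring
  refine ⟨F', ?_, ?_, hfar, ?_, ?_, ?_⟩
  · choose L' hL' using fun z => exists_lipschitzWith_spike hF η K z
    have : ∀ s : Finset ((Fin n → ℝ) × ℝ),
        ∃ C, LipschitzWith C fun y => ∑ z ∈ s, (spike F η K z y - F y) := by
      intro s
      induction s using Finset.induction_on with
      | empty => exact ⟨0, by simp [LipschitzWith.const (α := Fin n → ℝ) (0 : ℝ)]⟩
      | insert a s ha ih =>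
        obtain ⟨C, hC⟩ := ih
        simp only [Finset.sum_insert ha]
        exact ⟨_, ((hL' a).sub hF).add hC⟩
    obtain ⟨C, hC⟩ := this P
    exact ⟨_, hF.add hC⟩
  · intro y
    rcases hdich y with h | ⟨z, hz, hy, h⟩
    · rw [h, sub_self, abs_zero]; linarith
    · have h1 := hclose z hz y hy.le
      have h2 := abs_spike_sub_le hK.le h1
      rw [h]
      rw [abs_le] at *
      constructor <;> linarith [h1.1, h1.2, h2.1, h2.2]
  · intro y
    rcases hdich y with h | ⟨z, hz, hy, h⟩
    · exact Or.inl h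
    · rcases spike_cases (F := F) (η := η) (K := K) (z := z) (y := y) with h' | h'
      · exact Or.inl (h.trans h')
      · exact Or.inr ⟨z, hz, hy.le, by rw [h]; exact h'⟩
  · intro y z hz hy
    rw [hnear y z hz hy]
    exact abs_spike_sub_le hK.le (hclose z hz y hy.le)
  · intro x hx
    -- Off the spikes a nearby anchor serves. Inside a spike the anchor of that spike must be used,
    -- as `F' x` is only known to be within η of its own level.
    rcases hdich x with h | ⟨z, hz, hy, h⟩
    · obtain ⟨a, b, h1, h2, h3⟩ := hatt x hx
      exact ⟨a, b, h1, by rwa [h], fun o t ht => hval _ (h3 o) t ht⟩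
    · obtain ⟨a, h1, h3⟩ := hatt' x z hz hy
      refine ⟨a, z.2, h1, ?_, fun o t ht => hval _ (h3 o) t ht⟩
      rw [h]
      exact abs_spike_sub_le hK.le (hclose z hz x hy.le)

/-- A grid fine enough that `F` varies by at most η/2 over distance 2p allows one level `F a` for
all spikes of an anchor. The centers do not depend on ε, so ε can afterwards be taken as small as
desired. -/
theorem exists_isSpiking {n : ℕ} (hn : 0 < n) {F : (Fin n → ℝ) → ℝ} {L : ℝ≥0}
    (hF : LipschitzWith L F) {η : ℝ} (hη : 0 < η) :
    ∃ p, 0 < p ∧ p ≤ η ∧ ∃ P : Finset ((Fin n → ℝ) × ℝ),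
      ∀ᶠ ε in 𝓝[>] (0 : ℝ), ∃ F', IsSpiking F F' η p ε P := by
  classical
  obtain ⟨M, hM⟩ := exists_nat_gt (1 / η + 4 * L / η)
  have hM0 : (0 : ℝ) < M := lt_of_le_of_lt (by positivity) hM
  have hMn : 0 < M := by exact_mod_cast hM0
  rw [← add_div, div_lt_iff₀ hη] at hM
  set p : ℝ := 1 / (2 * M) with hp
  have hp0 : 0 < p := by positivity
  have hpM : 2 * p * M = 1 := by rw [hp]; field_simp
  have hpη : p ≤ η := by
    rw [hp, div_le_iff₀ (by positivity)]
    nlinarith [L.2]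
  have hLp : L * (2 * p) ≤ η / 2 := by
    have : L * (2 * p) = L / M := by rw [hp]; field_simp
    rw [this, div_le_iff₀ hM0]
    linarith
  -- The offset p/2 puts every center coordinate in p/2 + pℕ, below 1: distinct centers are at least
  -- p apart and all are at least p/2 from the boundary.
  let anchor : (Fin n → Fin M) → Fin n → ℝ := fun m i => 2 * p * m i + p / 2
  let dir : Option (Fin n) → Fin n → ℝ := fun o => o.elim 0 (fun j => Pi.single j 1)
  have hdir : ∀ o i, ∃ s : ℕ, s ≤ 1 ∧ dir o i = s := by
    intro o i
    rcases o with _ | j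
    · exact ⟨0, by simp, by simp [dir]⟩
    · by_cases h : i = j
      · subst h; exact ⟨1, le_rfl, by simp [dir]⟩
      · exact ⟨0, by simp, by simp [dir, h]⟩
  let pt : (Fin n → Fin M) × Option (Fin n) → (Fin n → ℝ) × ℝ :=
    fun k => (anchor k.1 + p • dir k.2, F (anchor k.1))
  have hdirn : ∀ o, ‖p • dir o‖ ≤ p := by
    intro o
    rw [pi_norm_le_iff_of_nonneg hp0.le]
    intro i
    obtain ⟨s, hs, hs'⟩ := hdir o i
    have : (s : ℝ) ≤ 1 := by exact_mod_cast hs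
    rw [Pi.smul_apply, hs', smul_eq_mul, Real.norm_of_nonneg (by positivity)]
    nlinarith
  have hcoord : ∀ m o i, ∃ k : ℕ, (pt (m, o)).1 i = p / 2 + p * k ∧ k < 2 * M ∧ k / 2 = m i := by
    intro m o i
    obtain ⟨s, hs, hs'⟩ := hdir o i
    refine ⟨2 * m i + s, ?_, ?_, ?_⟩
    · simp only [pt, anchor, Pi.add_apply, Pi.smul_apply, hs', smul_eq_mul]
      push_cast; ring
    · have := (m i).2; omega
    · omega
  refine ⟨p, hp0, hpη, Finset.univ.image pt, ?_⟩
  have hev : ∀ᶠ ε in 𝓝[>] (0 : ℝ), 0 < ε ∧ 2 * ε < p ∧ L * ε ≤ η / 2 := by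
    refine (eventually_mem_nhdsWithin (s := Ioi (0 : ℝ))).and
      ((?_ : ∀ᶠ ε in 𝓝[>] (0 : ℝ), 2 * ε < p).and ?_)
    · filter_upwards [Ioo_mem_nhdsGT (show (0 : ℝ) < p / 2 by positivity)] with e he
      linarith [he.2]
    · filter_upwards [Ioo_mem_nhdsGT (show (0 : ℝ) < 2 * p by positivity)] with e he
      have : (L : ℝ) * e ≤ L * (2 * p) := by gcongr; exact he.2.le
      linarith
  filter_upwards [hev] with ε ⟨hε, hεp, hLε⟩
  have hlip : ∀ x m, ‖x - anchor m‖ ≤ 2 * p → |F x - F (anchor m)| ≤ η / 2 := by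
    intro x m hx
    have h1 := hF.dist_le_mul x (anchor m)
    rw [Real.dist_eq, dist_eq_norm] at h1
    have : (L : ℝ) * ‖x - anchor m‖ ≤ L * (2 * p) := by gcongr
    linarith
  apply IsSpiking.of_spikes hn hF hη hε ?_ ?_ hLε ?_ ?_ ?_
  · intro z hz z' hz' hne
    simp only [Finset.mem_image, Finset.mem_univ, true_and, Prod.exists] at hz hz'
    obtain ⟨m, o, rfl⟩ := hz
    obtain ⟨m', o', rfl⟩ := hz'
    have hne1 : (pt (m, o)).1 ≠ (pt (m', o')).1 := by
      intro h
      apply hne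
      have : m = m' := by
        funext i
        obtain ⟨k, hk, -, hk2⟩ := hcoord m o i
        obtain ⟨k', hk', -, hk2'⟩ := hcoord m' o' i
        rw [h, hk'] at hk
        have : (k' : ℝ) = k := by
          have : p * (k' : ℝ) = p * k := by linarith
          exact mul_left_cancel₀ hp0.ne' this
        have : k' = k := by exact_mod_cast this
        apply Fin.ext
        omega
      subst this
      exact Prod.ext h rfl
    obtain ⟨i, hi⟩ := Function.ne_iff.1 hne1
    have h1 := norm_le_pi_norm ((pt (m, o)).1 - (pt (m', o')).1) i
    obtain ⟨k, hk, -, -⟩ := hcoord m o i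
    obtain ⟨k', hk', -, -⟩ := hcoord m' o' i
    rw [Pi.sub_apply, hk, hk'] at h1
    have hkk : (k : ℤ) - k' ≠ 0 := by
      intro h
      have : k = k' := by omega
      apply hi; rw [hk, hk', this]
    have h2 : (1 : ℝ) ≤ |(k : ℝ) - k'| := by
      exact_mod_cast Int.one_le_abs hkk
    have h3 : p / 2 + p * (k : ℝ) - (p / 2 + p * k') = p * (k - k') := by ring
    rw [h3, norm_mul, Real.norm_of_nonneg hp0.le, Real.norm_eq_abs] at h1
    nlinarith
  · intro z hz
    simp only [Finset.mem_image, Finset.mem_univ, true_and, Prod.exists] at hz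
    obtain ⟨m, o, rfl⟩ := hz
    apply hlip
    simp only [pt, add_sub_cancel_left]
    linarith [hdirn o]
  · intro z hz y hy
    simp only [Finset.mem_image, Finset.mem_univ, true_and, Prod.exists] at hz
    obtain ⟨m, o, rfl⟩ := hz
    have key : ∀ i, 0 ≤ y i ∧ y i ≤ 1 := by
      intro i
      obtain ⟨k, hk, hk1, -⟩ := hcoord m o i
      have h1 := (norm_le_pi_norm (y - (pt (m, o)).1) i).trans hy
      rw [Pi.sub_apply, hk, Real.norm_eq_abs, abs_le] at h1
      have hk2 : (k : ℝ) + 1 ≤ 2 * M := by exact_mod_cast hk1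
      have hk0 : 0 ≤ p * (k : ℝ) := by positivity
      have : p * ((k : ℝ) + 1) ≤ p * (2 * M) := by gcongr
      constructor <;> nlinarith [h1.1, h1.2]
    exact ⟨fun i => (key i).1, fun i => (key i).2⟩
  · intro x hx
    have hm : ∀ i, ∃ m : Fin M, |x i - (2 * p * m + p / 2)| ≤ 2 * p := by
      intro i
      have hx0 : 0 ≤ x i := hx.1 i
      have hx1 : x i ≤ 1 := hx.2 i
      have hxM : 0 ≤ x i * M := by positivity
      have key : ∀ k : ℕ, (k : ℝ) ≤ x i * M → x i * M ≤ k + 1 →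
          |x i - (2 * p * k + p / 2)| ≤ 2 * p := by
        intro k h1 h2
        have e1 : 2 * p * (x i * M) = x i := by
          calc 2 * p * (x i * M) = (2 * p * M) * x i := by ring
            _ = x i := by rw [hpM, one_mul]
        have h3 : 2 * p * (k : ℝ) ≤ 2 * p * (x i * M) := by gcongr
        have h4 : 2 * p * (x i * M) ≤ 2 * p * (k + 1) := by gcongr
        rw [abs_le]
        constructor <;> linarith
      by_cases hlt : ⌊x i * M⌋₊ < M
      · exact ⟨⟨_, hlt⟩, key _ (Nat.floor_le hxM) (Nat.lt_floor_add_one _).le⟩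
      · have hx2 : x i * M ≤ M := by nlinarith
        have h1 : (M : ℝ) ≤ x i * M := (Nat.cast_le.2 (not_lt.1 hlt)).trans (Nat.floor_le hxM)
        refine ⟨⟨M - 1, by omega⟩, key _ ?_ ?_⟩
        · rw [Nat.cast_sub hMn]; push_cast; linarith
        · rw [Nat.cast_sub hMn]; push_cast; linarith
    choose m hm using hm
    have hxm : ‖x - anchor m‖ ≤ 2 * p := by
      rw [pi_norm_le_iff_of_nonneg (by positivity)]
      intro i
      exact hm i
    refine ⟨anchor m, F (anchor m), hxm, by linarith [hlip x m hxm], fun o => ?_⟩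
    exact Finset.mem_image.2 ⟨(m, o), Finset.mem_univ _, rfl⟩
  · intro x z hz hx
    simp only [Finset.mem_image, Finset.mem_univ, true_and, Prod.exists] at hz
    obtain ⟨m, o, rfl⟩ := hz
    refine ⟨anchor m, ?_, fun o' => Finset.mem_image.2 ⟨(m, o'), Finset.mem_univ _, rfl⟩⟩
    have h2 := norm_sub_le_norm_sub_add_norm_sub x (pt (m, o)).1 (anchor m)
    have h3 : ‖(pt (m, o)).1 - anchor m‖ ≤ p := by
      simp only [pt, add_sub_cancel_left]; exact hdirn o
    linarith

/-! ### The iterated construction and its limit. -/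

/-- A sequence of functions, each arising from the preceding one by adding spikes, at rapidly
decreasing scales. The function `ψ` controls how small the spikes are. -/
structure SpikeSequence (n : ℕ) (ψ : ℝ → ℝ) where
  F : ℕ → (Fin n → ℝ) → ℝ
  η : ℕ → ℝ
  p : ℕ → ℝ
  ε : ℕ → ℝ
  P : ℕ → Finset ((Fin n → ℝ) × ℝ)
  F_zero : F 0 = 0
  η_zero : η 0 = 1
  η_succ : ∀ k, η (k + 1) = ε k / 8
  p_pos : ∀ k, 0 < p k
  p_le : ∀ k, p k ≤ η k
  ε_pos : ∀ k, 0 < ε k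
  ε_le : ∀ k, ε k ≤ (1 / 2) ^ k * p k
  card_le : ∀ k, ((P k).card : ℝ) * ψ (ε k) ≤ (1 / 2) ^ k
  isSpiking : ∀ k, IsSpiking (F k) (F (k + 1)) (η k) (p k) (ε k) (P k)

theorem nonempty_spikeSequence {n : ℕ} (hn : 0 < n) {ψ : ℝ → ℝ}
    (hψ : Tendsto ψ (𝓝[>] 0) (𝓝 0)) : Nonempty (SpikeSequence n ψ) := by
  let State := {F : (Fin n → ℝ) → ℝ // ∃ L, LipschitzWith L F} × {η : ℝ // 0 < η}
  have step : ∀ (k : ℕ) (s : State), ∃ (p ε : ℝ) (P : Finset ((Fin n → ℝ) × ℝ))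
      (F' : (Fin n → ℝ) → ℝ), 0 < p ∧ p ≤ s.2.1 ∧ 0 < ε ∧ ε ≤ (1 / 2) ^ k * p ∧
      (P.card : ℝ) * ψ ε ≤ (1 / 2) ^ k ∧ IsSpiking s.1.1 F' s.2.1 p ε P := by
    rintro k ⟨⟨F, L, hL⟩, ⟨η, hη⟩⟩
    obtain ⟨p, hp, hpη, P, hP⟩ := exists_isSpiking hn hL hη
    have h1 : ∀ᶠ ε in 𝓝[>] (0 : ℝ), ε ∈ Ioo 0 ((1 / 2) ^ k * p) :=
      Ioo_mem_nhdsGT (by positivity)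
    have h2 : ∀ᶠ ε in 𝓝[>] (0 : ℝ), (P.card : ℝ) * ψ ε ≤ (1 / 2) ^ k := by
      have := hψ.const_mul (P.card : ℝ)
      rw [mul_zero] at this
      exact (this.eventually_lt_const (by positivity)).mono fun _ h => h.le
    obtain ⟨ε, ⟨F', hF'⟩, hε, hPε⟩ := (hP.and (h1.and h2)).exists
    exact ⟨p, ε, P, F', hp, hpη, hε.1, hε.2.le, hPε, hF'⟩
  choose p ε P F' hp hpη hε hεp hP hF' using step
  let s0 : State := ⟨⟨0, 0, LipschitzWith.const 0⟩, ⟨1, one_pos⟩⟩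
  let next : ℕ → State → State := fun k s =>
    ⟨⟨F' k s, (hF' k s).lipschitz⟩, ⟨ε k s / 8, by have := hε k s; positivity⟩⟩
  let S : ℕ → State := fun k => Nat.rec s0 next k
  exact ⟨{
    F := fun k => (S k).1.1
    η := fun k => (S k).2.1
    p := fun k => p k (S k)
    ε := fun k => ε k (S k)
    P := fun k => P k (S k)
    F_zero := rfl
    η_zero := rfl
    η_succ := fun k => rfl
    p_pos := fun k => hp k _
    p_le := fun k => hpη k _
    ε_pos := fun k => hε k _
    ε_le := fun k => hεp k _
    card_le := fun k => hP k _
    isSpiking := fun k => hF' k _ }⟩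

namespace SpikeSequence

variable {n : ℕ} {ψ : ℝ → ℝ} (s : SpikeSequence n ψ)

theorem η_pos (k : ℕ) : 0 < s.η k := (s.p_pos k).trans_le (s.p_le k)

theorem ε_le_p (k : ℕ) : s.ε k ≤ s.p k :=
  (s.ε_le k).trans (mul_le_of_le_one_left (s.p_pos k).le (pow_le_one₀ (by norm_num) (by norm_num)))

theorem ε_le_η (k : ℕ) : s.ε k ≤ s.η k := (s.ε_le_p k).trans (s.p_le k)

theorem ε_succ_le (k : ℕ) : s.ε (k + 1) ≤ s.ε k / 8 := by
  rw [← s.η_succ]; exact s.ε_le_η _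

theorem ε_antitone : Antitone s.ε :=
  antitone_nat_of_succ_le fun k => by linarith [s.ε_succ_le k, s.ε_pos k]

theorem η_le_one (k : ℕ) : s.η k ≤ 1 := by
  induction k with
  | zero => exact s.η_zero.le
  | succ k ih => rw [s.η_succ]; linarith [s.ε_le_η k, s.ε_pos k]

theorem ε_le_half_pow (k : ℕ) : s.ε k ≤ (1 / 2) ^ k :=
  (s.ε_le k).trans (mul_le_of_le_one_right (by positivity) ((s.p_le k).trans (s.η_le_one k)))

theorem tendsto_ε : Tendsto s.ε atTop (𝓝[>] 0) := by
  refine tendsto_nhdsWithin_iff.2 ⟨?_, Eventually.of_forall s.ε_pos⟩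
  exact squeeze_zero (fun k => (s.ε_pos k).le) s.ε_le_half_pow
    (tendsto_pow_atTop_nhds_zero_of_lt_one (by norm_num) (by norm_num))

theorem tendsto_p : Tendsto s.p atTop (𝓝 0) := by
  rw [← tendsto_add_atTop_iff_nat 1]
  refine squeeze_zero (fun k => (s.p_pos _).le) (g := s.ε) (fun k => ?_)
    (tendsto_nhdsWithin_iff.1 s.tendsto_ε).1
  have := s.p_le (k + 1)
  rw [s.η_succ] at this
  linarith [s.ε_pos k]

/-- A step changes values by at most 2η_(j+1) = ε_j/4, which is below ε_j - ε_(j+1) because ε_(j+1)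
≤ ε_j/8; the bounds telescope. -/
theorem abs_F_sub_le (k m : ℕ) (y : Fin n → ℝ) :
    |s.F (k + 1 + m) y - s.F (k + 1) y| ≤ s.ε k - s.ε (k + m) := by
  induction m with
  | zero => simp
  | succ m ih =>
    have h1 := (s.isSpiking (k + 1 + m)).dist_le y
    have e : k + 1 + m = k + m + 1 := by ring
    rw [e] at h1 ih
    rw [s.η_succ] at h1
    have h2 := s.ε_succ_le (k + m)
    have h3 := abs_sub_le (s.F (k + m + 1 + 1) y) (s.F (k + m + 1) y) (s.F (k + 1) y)
    have h4 := s.ε_pos (k + m)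
    rw [show k + 1 + (m + 1) = k + m + 1 + 1 by ring, show k + (m + 1) = k + m + 1 by ring]
    linarith

theorem cauchySeq_F (y : Fin n → ℝ) : CauchySeq fun k => s.F (k + 1) y := by
  refine cauchySeq_of_le_tendsto_0' s.ε (fun k m hkm => ?_)
    (tendsto_nhdsWithin_iff.1 s.tendsto_ε).1
  obtain ⟨m, rfl⟩ := Nat.exists_eq_add_of_le hkm
  have h := s.abs_F_sub_le k m y
  rw [dist_comm, Real.dist_eq, show k + m + 1 = k + 1 + m by ring]
  linarith [s.ε_pos (k + m)]

/-- The limit of a sequence of spiked functions. -/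
noncomputable def lim (y : Fin n → ℝ) : ℝ := (cauchySeq_tendsto_of_complete (s.cauchySeq_F y)).choose

theorem tendsto_lim (y : Fin n → ℝ) : Tendsto (fun k => s.F (k + 1) y) atTop (𝓝 (s.lim y)) :=
  (cauchySeq_tendsto_of_complete (s.cauchySeq_F y)).choose_spec

theorem abs_lim_sub_le (k : ℕ) (y : Fin n → ℝ) : |s.lim y - s.F (k + 1) y| ≤ s.ε k := by
  have h1 := ((tendsto_add_atTop_iff_nat k).2 (s.tendsto_lim y)).sub_const (s.F (k + 1) y)
  refine le_of_tendsto h1.abs (Eventually.of_forall fun m => ?_)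
  have := s.abs_F_sub_le k m y
  rw [show m + k + 1 = k + 1 + m by ring]
  linarith [s.ε_pos (k + m)]

theorem lipschitz_F (k : ℕ) : ∃ L, LipschitzWith L (s.F k) := by
  cases k with
  | zero => exact ⟨0, by rw [s.F_zero]; exact LipschitzWith.const 0⟩
  | succ k => exact (s.isSpiking k).lipschitz

theorem continuous_lim : Continuous s.lim := by
  have : TendstoUniformly (fun k => s.F (k + 1)) s.lim atTop := by
    rw [Metric.tendstoUniformly_iff]
    intro e he
    have := (tendsto_nhdsWithin_iff.1 s.tendsto_ε).1.eventually_lt_const he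
    filter_upwards [this] with k hk y
    rw [Real.dist_eq]
    exact (s.abs_lim_sub_le k y).trans_lt hk
  exact this.continuous (Frequently.of_forall fun k => (s.lipschitz_F _).choose_spec.continuous)

theorem exists_points (k : ℕ) {x : Fin n → ℝ} (hx : x ∈ Icc (0 : Fin n → ℝ) 1) :
    ∃ (a : Fin n → ℝ) (σ : ℝ), ‖x - a‖ ≤ 2 * s.p k ∧ |σ| = s.p k ∧
      ∀ (o : Option (Fin n)), ∀ τ ∈ ({0, σ} : Set ℝ), ∃ y ∈ Icc (0 : Fin n → ℝ) 1,
        ‖y - (a + s.p k • o.elim 0 (fun j => Pi.single j 1))‖ ≤ s.ε k ∧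
        |s.lim y - s.lim x - τ| ≤ 2 * s.ε k := by
  obtain ⟨a, b, h1, h2, h3⟩ := (s.isSpiking k).attains x hx
  have hp := s.p_pos k
  have hpη := s.p_le k
  rw [abs_le] at h2
  -- Moving from `F (k + 1) x` towards b by p ≤ η stays in the swept interval.
  obtain ⟨σ, hσ, hσb⟩ : ∃ σ, |σ| = s.p k ∧ |s.F (k + 1) x + σ - b| ≤ s.η k := by
    rcases le_total (s.F (k + 1) x) b with h | h
    · exact ⟨s.p k, abs_of_pos hp, abs_le.2 ⟨by linarith, by linarith⟩⟩
    · exact ⟨-s.p k, by rw [abs_neg, abs_of_pos hp], abs_le.2 ⟨by linarith, by linarith⟩⟩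
  refine ⟨a, σ, h1, hσ, fun o τ hτ => ?_⟩
  have hτb : |s.F (k + 1) x + τ - b| ≤ s.η k := by
    rcases hτ with rfl | rfl
    · rw [add_zero]; exact abs_le.2 h2
    · exact hσb
  obtain ⟨y, hy, hy1, hy2⟩ := h3 o _ hτb
  refine ⟨y, hy, hy1, ?_⟩
  have h4 := abs_le.1 (s.abs_lim_sub_le k x)
  have h5 := abs_le.1 (s.abs_lim_sub_le k y)
  rw [abs_le]
  constructor <;> linarith [h4.1, h4.2, h5.1, h5.2]

/-- No nonzero linear form is `o(‖y - x‖ + |lim y - lim x|)` on the graph of the limit. -/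
theorem eq_zero_of_isLittleO {x : Fin n → ℝ} (hx : x ∈ Icc (0 : Fin n → ℝ) 1)
    (l : (Fin n → ℝ) →L[ℝ] ℝ) (β : ℝ)
    (h : ∀ θ > 0, ∃ δ > 0, ∀ y ∈ Icc (0 : Fin n → ℝ) 1, ‖y - x‖ < δ → |s.lim y - s.lim x| < δ →
      |l (y - x) + β * (s.lim y - s.lim x)| ≤ θ * (‖y - x‖ + |s.lim y - s.lim x|)) :
    l = 0 ∧ β = 0 := by
  set C := ‖l‖ + 2 * |β| with hC
  -- The form is almost zero at the ideal positions. Subtracting τ = 0 from τ = σ isolates β, and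
  -- subtracting the anchor from its j-th neighbour isolates `l` on the j-th basis vector.
  have key : ∀ θ > 0, ∃ (a : Fin n → ℝ) (p σ : ℝ), 0 < p ∧ |σ| = p ∧ ∀ o : Option (Fin n),
      ∀ τ ∈ ({0, σ} : Set ℝ),
      |l (a - x) + p * l (o.elim 0 (fun j => Pi.single j 1)) + β * τ| ≤ θ * p := by
    intro θ hθ
    obtain ⟨δ, hδ, hd⟩ := h (θ / 14) (by positivity)
    have ev1 : ∀ᶠ k in atTop, s.p k < δ / 7 := s.tendsto_p.eventually_lt_const (by positivity)
    have ev2 : ∀ᶠ k in atTop, (1 / 2 : ℝ) ^ k * C ≤ θ / 2 := by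
      have := (tendsto_pow_atTop_nhds_zero_of_lt_one (r := (1 / 2 : ℝ)) (by norm_num)
        (by norm_num)).mul_const C
      rw [zero_mul] at this
      exact (this.eventually_lt_const (by positivity)).mono fun _ h => h.le
    obtain ⟨k, hk1, hk2⟩ := (ev1.and ev2).exists
    obtain ⟨a, σ, ha, hσ, hpt⟩ := s.exists_points k hx
    have hp := s.p_pos k
    refine ⟨a, s.p k, σ, hp, hσ, fun o τ hτ => ?_⟩
    obtain ⟨y, hy, hy1, hy2⟩ := hpt o τ hτ
    set e : Fin n → ℝ := o.elim 0 (fun j => Pi.single j 1) with he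
    have hε := s.ε_le_p k
    have he1 : ‖e‖ ≤ 1 := by
      rw [he]
      rcases o with _ | j
      · simp
      · exact (Pi.norm_single (G := fun _ : Fin n => ℝ) (1 : ℝ)).le.trans norm_one.le
    have hpe : ‖s.p k • e‖ ≤ s.p k := by
      rw [norm_smul, Real.norm_of_nonneg hp.le]
      exact mul_le_of_le_one_right hp.le he1
    have hyx : ‖y - x‖ ≤ 4 * s.p k := by
      have : y - x = (y - (a + s.p k • e)) + (s.p k • e - (x - a)) := by abel
      rw [this]
      linarith [norm_add_le (y - (a + s.p k • e)) (s.p k • e - (x - a)),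
        norm_sub_le (s.p k • e) (x - a)]
    have hτp : |τ| ≤ s.p k := by
      rcases hτ with rfl | rfl
      · simpa using hp.le
      · exact hσ.le
    have hfx : |s.lim y - s.lim x| ≤ 3 * s.p k := by
      have := abs_sub_abs_le_abs_sub (s.lim y - s.lim x) τ
      linarith
    have hmain := hd y hy (by linarith) (by linarith)
    have hε2 : s.ε k * C ≤ θ / 2 * s.p k := by
      calc s.ε k * C ≤ ((1 / 2) ^ k * s.p k) * C := by gcongr; exact s.ε_le k
        _ = ((1 / 2) ^ k * C) * s.p k := by ring
        _ ≤ _ := by gcongr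
    have hsplit : l (a - x) + s.p k * l e + β * τ = (l (y - x) + β * (s.lim y - s.lim x)) -
        (l (y - (a + s.p k • e)) + β * (s.lim y - s.lim x - τ)) := by
      simp only [map_sub, map_add, map_smul, smul_eq_mul]; ring
    rw [hsplit]
    have hl := l.le_opNorm (y - (a + s.p k • e))
    rw [Real.norm_eq_abs] at hl
    have hl2 : ‖l‖ * ‖y - (a + s.p k • e)‖ ≤ ‖l‖ * s.ε k := by gcongr
    have hb : |β * (s.lim y - s.lim x - τ)| ≤ |β| * (2 * s.ε k) := by
      rw [abs_mul]; gcongr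
    have t1 := abs_sub (l (y - x) + β * (s.lim y - s.lim x))
      (l (y - (a + s.p k • e)) + β * (s.lim y - s.lim x - τ))
    have t2 := abs_add_le (l (y - (a + s.p k • e))) (β * (s.lim y - s.lim x - τ))
    -- The points used satisfy ‖y - x‖ ≤ 4p and |lim y - lim x| ≤ 3p, hence 14 = 2 · 7; the other
    -- θ/2 absorbs the error of order ε.
    have t3 : θ / 14 * (‖y - x‖ + |s.lim y - s.lim x|) ≤ θ / 14 * (7 * s.p k) := by
      gcongr; linarith
    have t4 : ‖l‖ * s.ε k + |β| * (2 * s.ε k) = s.ε k * C := by rw [hC]; ring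
    linarith
  have hβ : β = 0 := by
    by_contra hne
    have hpos : 0 < |β| := abs_pos.2 hne
    obtain ⟨a, p, σ, hp, hσ, hk⟩ := key (|β| / 4) (by positivity)
    have h1 := abs_le.1 (hk none 0 (by simp))
    have h2 := abs_le.1 (hk none σ (by simp))
    have h3 : |β * σ| ≤ |β| / 2 * p := by
      rw [abs_le]; constructor <;> linarith [h1.1, h1.2, h2.1, h2.2]
    rw [abs_mul, hσ] at h3
    nlinarith [mul_pos hpos hp]
  refine ⟨?_, hβ⟩
  have hl : ∀ j, l (Pi.single j 1) = 0 := by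
    intro j
    by_contra hne
    have hpos : 0 < |l (Pi.single j 1)| := abs_pos.2 hne
    obtain ⟨a, p, σ, hp, hσ, hk⟩ := key (|l (Pi.single j 1)| / 4) (by positivity)
    have h1 := abs_le.1 (hk none 0 (by simp))
    have h2 := abs_le.1 (hk (some j) 0 (by simp))
    simp only [Option.elim_none, Option.elim_some, map_zero, mul_zero, add_zero] at h1 h2
    have h3 : |p * l (Pi.single j 1)| ≤ |l (Pi.single j 1)| / 2 * p := by
      rw [abs_le]; constructor <;> linarith [h1.1, h1.2, h2.1, h2.2]
    rw [abs_mul, abs_of_pos hp] at h3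
    nlinarith [mul_pos hpos hp]
  apply ContinuousLinearMap.coe_injective
  apply LinearMap.pi_ext'
  intro j
  ext
  simpa using hl j

end SpikeSequence

/-! ### The graph: no tangent plane, no derivative. -/

/-- The identification of `ℝ^n × ℝ` with `ℝ^(n+1)`, the last factor becoming the coordinate `0`. -/
noncomputable def consEuclidean (n : ℕ) :
    ((Fin n → ℝ) × ℝ) →L[ℝ] EuclideanSpace ℝ (Fin (n + 1)) :=
  LinearMap.toContinuousLinearMap
    { toFun := fun z => WithLp.toLp 2 (Fin.cons z.2 z.1 : Fin (n + 1) → ℝ)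
      map_add' := fun z w => by
        ext i; refine Fin.cases ?_ (fun j => ?_) i <;> simp
      map_smul' := fun c z => by
        ext i; refine Fin.cases ?_ (fun j => ?_) i <;> simp }

@[simp] theorem consEuclidean_zero {n : ℕ} (z : (Fin n → ℝ) × ℝ) : consEuclidean n z 0 = z.2 := rfl

@[simp] theorem consEuclidean_succ {n : ℕ} (z : (Fin n → ℝ) × ℝ) (i : Fin n) :
    consEuclidean n z i.succ = z.1 i := rfl

/-- The map `x ↦ (x, f x)` onto the graph of `f`. -/
noncomputable def graphMap {n : ℕ} (f : (Fin n → ℝ) → ℝ) (x : EuclideanSpace ℝ (Fin n)) :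
    EuclideanSpace ℝ (Fin (n + 1)) :=
  consEuclidean n (x.ofLp, f x.ofLp)

theorem mem_unitCube_iff {n : ℕ} {x : EuclideanSpace ℝ (Fin n)} :
    x ∈ unitCube n ↔ x.ofLp ∈ Icc (0 : Fin n → ℝ) 1 :=
  ⟨fun h => ⟨fun i => (h i).1, fun i => (h i).2⟩, fun h i => ⟨h.1 i, h.2 i⟩⟩

theorem isCompact_unitCube (n : ℕ) : IsCompact (unitCube n) := by
  have : unitCube n = WithLp.toLp 2 '' Icc (0 : Fin n → ℝ) 1 := by
    ext x
    rw [mem_unitCube_iff]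
    exact ⟨fun h => ⟨_, h, rfl⟩, by rintro ⟨y, hy, rfl⟩; exact hy⟩
  rw [this]
  exact isCompact_Icc.image (PiLp.continuous_toLp 2 _)

theorem continuous_graphMap {n : ℕ} {f : (Fin n → ℝ) → ℝ} (hf : Continuous f) :
    Continuous (graphMap f) := by
  have h := PiLp.continuous_ofLp 2 (fun _ : Fin n => ℝ)
  exact (consEuclidean n).continuous.comp (h.prodMk (hf.comp h))

theorem graphMap_injective {n : ℕ} (f : (Fin n → ℝ) → ℝ) : Function.Injective (graphMap f) := by
  intro x y h
  ext i
  simpa [graphMap] using congrArg (fun z : EuclideanSpace ℝ (Fin (n + 1)) => z i.succ) h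

theorem exists_homeomorph_graph {n : ℕ} {f : (Fin n → ℝ) → ℝ} (hf : Continuous f) :
    ∃ e : unitCube n ≃ₜ (graphMap f '' unitCube n : Set (EuclideanSpace ℝ (Fin (n + 1)))),
      ∀ x : unitCube n, (e x : EuclideanSpace ℝ (Fin (n + 1))) = graphMap f x := by
  have : CompactSpace (unitCube n) := isCompact_iff_compactSpace.1 (isCompact_unitCube n)
  let e := Equiv.Set.image (graphMap f) (unitCube n) (graphMap_injective f)
  have he : Continuous e :=
    ((continuous_graphMap hf).comp continuous_subtype_val).subtype_mk _
  exact ⟨he.homeoOfEquivCompactToT2, fun x => rfl⟩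

/-- Compactness of the unit sphere: the directions of counterexamples subconverge to a contingent
direction u with |L u| ≥ θ, although L u = 0. -/
theorem abs_le_of_sUnion_contingent_subset {V : Type*} [NormedAddCommGroup V] [NormedSpace ℝ V]
    [FiniteDimensional ℝ V] {E : Set V} {x : V} (L : V →L[ℝ] ℝ)
    (hL : ∀ z ∈ ⋃₀ contingent E x, L (z - x) = 0) {θ : ℝ} (hθ : 0 < θ) :
    ∃ δ > 0, ∀ y ∈ E, ‖y - x‖ < δ → |L (y - x)| ≤ θ * ‖y - x‖ := by
  by_contra! hcon
  choose y hyE hyδ hyθ using fun k : ℕ => hcon (1 / ((k : ℝ) + 1)) (by positivity)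
  have hne : ∀ k, y k ≠ x := by
    intro k h
    have := hyθ k
    simp [h] at this
  have hpos : ∀ k, 0 < ‖y k - x‖ := fun k => norm_pos_iff.2 (sub_ne_zero.2 (hne k))
  have hlim : Tendsto y atTop (𝓝 x) := by
    rw [tendsto_iff_norm_sub_tendsto_zero]
    exact squeeze_zero (fun k => norm_nonneg _) (fun k => (hyδ k).le)
      tendsto_one_div_add_atTop_nhds_zero_nat
  have hsphere : ∀ k, ‖y k - x‖⁻¹ • (y k - x) ∈ Metric.sphere (0 : V) 1 := by
    intro k
    rw [mem_sphere_zero_iff_norm, norm_smul, norm_inv, norm_norm, inv_mul_cancel₀ (hpos k).ne']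
  have : ProperSpace V := FiniteDimensional.proper ℝ V
  obtain ⟨u, hu, φ, hφ, hφu⟩ := (isCompact_sphere (0 : V) 1).tendsto_subseq hsphere
  have hLu : L u = 0 := by
    have := hL (x + u) ⟨halfLine x u, ⟨u, mem_sphere_zero_iff_norm.1 hu, rfl, y ∘ φ,
      fun k => ⟨hyE _, hne _⟩, hlim.comp hφ.tendsto_atTop, hφu⟩, 1, zero_le_one, by simp⟩
    simpa using this
  have hge : θ ≤ |L u| := by
    refine ge_of_tendsto ((L.continuous.tendsto u).comp hφu).abs (Eventually.of_forall fun k => ?_)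
    simp only [Function.comp_apply, map_smul, smul_eq_mul, abs_mul, abs_inv, abs_norm]
    rw [inv_mul_eq_div, le_div_iff₀ (hpos _)]
    exact (hyθ _).le
  rw [hLu, abs_zero] at hge
  linarith

namespace SpikeSequence

variable {n : ℕ} {ψ : ℝ → ℝ} (s : SpikeSequence n ψ)

/-- An n-plane in ℝ^(n+1) is annihilated by a nonzero form, which would then be negligible along the
graph. -/
theorem not_hasTangentPlaneAt {x : EuclideanSpace ℝ (Fin (n + 1))}
    (hx : x ∈ graphMap s.lim '' unitCube n) :
    ¬ HasTangentPlaneAt n (graphMap s.lim '' unitCube n) x := by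
  rintro ⟨Q, hxQ, hrank, hQ⟩
  obtain ⟨x, hx, rfl⟩ := hx
  have hlt : Q.direction < ⊤ := by
    refine lt_top_iff_ne_top.2 fun h => ?_
    rw [h, finrank_top, finrank_euclideanSpace_fin] at hrank
    omega
  obtain ⟨L, hL0, hL⟩ := Submodule.exists_le_ker_of_lt_top _ hlt
  apply hL0
  set L' : EuclideanSpace ℝ (Fin (n + 1)) →L[ℝ] ℝ := LinearMap.toContinuousLinearMap L with hL'
  have hvan : ∀ z ∈ ⋃₀ contingent (graphMap s.lim '' unitCube n) (graphMap s.lim x),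
      L' (z - graphMap s.lim x) = 0 := by
    intro z hz
    rw [hQ] at hz
    exact hL (AffineSubspace.vsub_mem_direction hz hxQ)
  set J := consEuclidean n with hJ
  obtain ⟨h1, h2⟩ := s.eq_zero_of_isLittleO (mem_unitCube_iff.1 hx)
    (L'.comp (J.comp (ContinuousLinearMap.inl ℝ _ _))) (L' (J (0, 1))) (by
      intro θ hθ
      obtain ⟨δ, hδ, hd⟩ := abs_le_of_sUnion_contingent_subset L' hvan
        (show 0 < θ / (‖J‖ + 1) by positivity)
      refine ⟨δ / (‖J‖ + 1), by positivity, fun y hy hy1 hy2 => ?_⟩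
      have hsub : graphMap s.lim (WithLp.toLp 2 y) - graphMap s.lim x =
          J (y - x.ofLp, s.lim y - s.lim x.ofLp) := by
        rw [graphMap, graphMap, ← map_sub, Prod.mk_sub_mk]
      have hnorm : ‖graphMap s.lim (WithLp.toLp 2 y) - graphMap s.lim x‖ ≤
          (‖J‖ + 1) * max ‖y - x.ofLp‖ |s.lim y - s.lim x.ofLp| := by
        rw [hsub]
        refine (J.le_opNorm _).trans ?_
        rw [Prod.norm_mk, Real.norm_eq_abs]
        gcongr
        linarith
      have hmain := hd _ (mem_image_of_mem _ (mem_unitCube_iff.2 hy)) (hnorm.trans_lt (by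
        rw [mul_comm, ← lt_div_iff₀ (by positivity)]
        exact max_lt hy1 hy2))
      have hval : L' (graphMap s.lim (WithLp.toLp 2 y) - graphMap s.lim x) =
          L'.comp (J.comp (ContinuousLinearMap.inl ℝ _ _)) (y - x.ofLp) +
            L' (J (0, 1)) * (s.lim y - s.lim x.ofLp) := by
        have : (y - x.ofLp, s.lim y - s.lim x.ofLp) =
            (y - x.ofLp, (0 : ℝ)) + (s.lim y - s.lim x.ofLp) • ((0 : Fin n → ℝ), (1 : ℝ)) := by
          simp
        rw [hsub, this, map_add, map_add, map_smul, map_smul, smul_eq_mul, mul_comm]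
        rfl
      rw [← hval]
      refine hmain.trans ?_
      calc θ / (‖J‖ + 1) * ‖graphMap s.lim (WithLp.toLp 2 y) - graphMap s.lim x‖
          ≤ θ / (‖J‖ + 1) * ((‖J‖ + 1) * max ‖y - x.ofLp‖ |s.lim y - s.lim x.ofLp|) := by gcongr
        _ = θ * max ‖y - x.ofLp‖ |s.lim y - s.lim x.ofLp| := by field_simp
        _ ≤ _ := by
          gcongr
          exact max_le_add_of_nonneg (norm_nonneg _) (abs_nonneg _))
  ext z
  have hz : z = J (fun i => z i.succ, 0) + z 0 • J (0, 1) := by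
    ext i
    refine Fin.cases ?_ (fun j => ?_) i <;> simp [hJ]
  have e1 := DFunLike.congr_fun h1 (fun i => z i.succ)
  have : L' z = 0 := by
    rw [hz, map_add, map_smul, h2, smul_zero, add_zero]
    exact e1
  exact this

theorem not_differentiableWithinAt {x : EuclideanSpace ℝ (Fin n)} (hx : x ∈ unitCube n) :
    ¬ DifferentiableWithinAt ℝ (graphMap s.lim) (unitCube n) x := by
  intro hd
  let T := (EuclideanSpace.equiv (Fin n) ℝ).symm
  have h1 : DifferentiableWithinAt ℝ s.lim (Icc 0 1) x.ofLp := by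
    have hT : DifferentiableWithinAt ℝ (fun y : Fin n → ℝ => T y) (Icc 0 1) x.ofLp :=
      T.differentiableAt.differentiableWithinAt
    have h2 : DifferentiableWithinAt ℝ (graphMap s.lim ∘ fun y : Fin n → ℝ => T y) (Icc 0 1)
        x.ofLp :=
      DifferentiableWithinAt.comp (t := unitCube n) _ hd hT
        fun y hy => mem_unitCube_iff.2 hy
    exact (EuclideanSpace.proj (𝕜 := ℝ) (0 : Fin (n + 1))).differentiableAt.comp_differentiableWithinAt
      x.ofLp h2
  obtain ⟨A, hA⟩ := h1
  have := (s.eq_zero_of_isLittleO (mem_unitCube_iff.1 hx) (-A) 1 (by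
    intro θ hθ
    have := (hasFDerivWithinAt_iff_isLittleO.1 hA).def hθ
    rw [eventually_nhdsWithin_iff, Metric.eventually_nhds_iff] at this
    obtain ⟨δ, hδ, h⟩ := this
    refine ⟨δ, hδ, fun y hy hy1 _ => ?_⟩
    have := h (by rwa [dist_eq_norm]) hy
    rw [Real.norm_eq_abs] at this
    have e : (-A) (y - x.ofLp) + 1 * (s.lim y - s.lim x.ofLp) =
        s.lim y - s.lim x.ofLp - A (y - x.ofLp) := by
      rw [neg_apply]; ring
    rw [e]
    refine this.trans ?_
    gcongr
    exact le_add_of_nonneg_right (abs_nonneg _))).2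
  exact one_ne_zero this

/-! ### Lower scaled oscillation and gauge measure. -/

/-- The points that lie in infinitely many of the doubled balls around the spikes. -/
def spikeSet : Set (EuclideanSpace ℝ (Fin n)) :=
  {x | ∃ᶠ k in atTop, ∃ z ∈ s.P k, ‖x.ofLp - z.1‖ < 2 * s.ε k}

/-- From some step k₀ on, the ball of radius ε_k around x misses all spikes of steps k₀ to k, so
there `F (k + 1)` is the Lipschitz function `F k₀` and the limit oscillates by at most (L + 2) ε_k.
-/
theorem lowerScaledOscillation_lt_top {x : unitCube n}
    (hx : (x : EuclideanSpace ℝ (Fin n)) ∉ s.spikeSet) :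
    lowerScaledOscillation (fun y : unitCube n => graphMap s.lim y) x < ∞ := by
  have hx' : ∀ᶠ k in atTop, ∀ z ∈ s.P k, 2 * s.ε k ≤ ‖x.1.ofLp - z.1‖ := by
    have := not_frequently.1 hx
    filter_upwards [this] with k hk z hz
    by_contra! h
    exact hk ⟨z, hz, h⟩
  obtain ⟨k₀, hk₀⟩ := eventually_atTop.1 hx'
  obtain ⟨L, hL⟩ := s.lipschitz_F k₀
  have hconst : ∀ k ≥ k₀, ∀ y, ‖y - x.1.ofLp‖ ≤ s.ε k →
      s.F (k + 1) y = s.F k₀ y := by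
    intro k hk
    induction k, hk using Nat.le_induction with
    | base =>
      intro y hy
      apply (s.isSpiking k₀).eq_of_far
      intro z hz
      have h1 := hk₀ k₀ le_rfl z hz
      have h2 := norm_sub_le_norm_sub_add_norm_sub x.1.ofLp y z.1
      rw [norm_sub_rev _ y] at h2
      linarith
    | succ k hk ih =>
      intro y hy
      rw [← ih y (hy.trans (s.ε_antitone k.le_succ))]
      apply (s.isSpiking (k + 1)).eq_of_far
      intro z hz
      have h1 := hk₀ (k + 1) (hk.trans k.le_succ) z hz
      have h2 := norm_sub_le_norm_sub_add_norm_sub x.1.ofLp y z.1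
      rw [norm_sub_rev _ y] at h2
      linarith
  set C : ℝ := ‖consEuclidean n‖ * (L + 3) with hC
  have hbound : ∀ k ≥ k₀, (⨆ y ∈ Metric.closedBall x (s.ε k),
      ‖graphMap s.lim (y : unitCube n) - graphMap s.lim x‖ₑ) / ENNReal.ofReal (s.ε k) ≤
        ENNReal.ofReal C := by
    intro k hk
    have hε := s.ε_pos k
    apply ENNReal.div_le_of_le_mul
    rw [← ENNReal.ofReal_mul (by positivity)]
    refine iSup₂_le fun y hy => ?_
    rw [← ofReal_norm]
    apply ENNReal.ofReal_le_ofReal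
    have hy1 : ‖y.1.ofLp - x.1.ofLp‖ ≤ s.ε k := by
      rw [pi_norm_le_iff_of_nonneg hε.le]
      intro i
      rw [Metric.mem_closedBall, Subtype.dist_eq, dist_eq_norm] at hy
      exact (PiLp.norm_apply_le (y.1 - x.1) i).trans hy
    have h1 := abs_le.1 (s.abs_lim_sub_le k y.1.ofLp)
    have h2 := abs_le.1 (s.abs_lim_sub_le k x.1.ofLp)
    rw [hconst k hk _ hy1] at h1
    rw [hconst k hk _ (by simpa using hε.le)] at h2
    have h3 := hL.dist_le_mul y.1.ofLp x.1.ofLp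
    rw [Real.dist_eq, dist_eq_norm] at h3
    have h4 := abs_le.1 (h3.trans (mul_le_mul_of_nonneg_left hy1 L.2))
    have h5 : |s.lim y.1.ofLp - s.lim x.1.ofLp| ≤ (L + 2) * s.ε k := by
      rw [abs_le]; constructor <;> linarith [h1.1, h1.2, h2.1, h2.2, h4.1, h4.2]
    rw [graphMap, graphMap, ← map_sub, Prod.mk_sub_mk]
    refine ((consEuclidean n).le_opNorm _).trans ?_
    rw [hC, mul_assoc]
    gcongr
    rw [Prod.norm_mk, Real.norm_eq_abs]
    have hL0 : 0 ≤ (L : ℝ) * s.ε k := by positivity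
    exact max_le (by linarith) (by linarith)
  refine lt_of_le_of_lt ?_ (ENNReal.ofReal_lt_top (r := C))
  refine liminf_le_of_frequently_le' ?_
  refine s.tendsto_ε.frequently ?_
  exact (eventually_atTop.2 ⟨k₀, hbound⟩).frequently

end SpikeSequence

/-- Borel–Cantelli: each tail of the family covers `s`, and tails of a convergent series tend to 0.
-/
theorem mkMetric_eq_zero_of_frequently_mem {X : Type*} [EMetricSpace X] [MeasurableSpace X]
    [BorelSpace X] (m : ℝ≥0∞ → ℝ≥0∞) {ι : ℕ → Type*} [∀ k, Fintype (ι k)] {U : ∀ k, ι k → Set X}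
    {r : ℕ → ℝ≥0∞} (hr : Tendsto r atTop (𝓝 0)) (hr' : Antitone r)
    (hU : ∀ k i, Metric.ediam (U k i) ≤ r k)
    (hsum : ∑' k, ∑ i, m (Metric.ediam (U k i)) ≠ ∞) {s : Set X}
    (hs : ∀ x ∈ s, ∃ᶠ k in atTop, ∃ i, x ∈ U k i) : Measure.mkMetric m s = 0 := by
  have h := Measure.mkMetric_le_liminf_tsum (ι := fun K => Σ k, ι (k + K)) s r hr
    (fun K i => U (i.1 + K) i.2)
    (Eventually.of_forall fun K i => (hU _ _).trans (hr' (Nat.le_add_left K i.1)))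
    (Eventually.of_forall fun K x hx => by
      obtain ⟨k, hk, i, hi⟩ := (frequently_atTop.1 (hs x hx)) K
      obtain ⟨j, rfl⟩ := Nat.exists_eq_add_of_le' hk
      exact mem_iUnion.2 ⟨⟨j, i⟩, hi⟩) m
  have hlim : Tendsto (fun K => ∑' i : Σ k, ι (k + K), m (Metric.ediam (U (i.1 + K) i.2))) atTop
      (𝓝 0) := by
    have := ENNReal.tendsto_sum_nat_add _ hsum
    refine this.congr fun K => ?_
    rw [ENNReal.tsum_sigma fun k (i : ι (k + K)) => m (Metric.ediam (U (k + K) i))]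
    simp only [tsum_fintype]
  rw [hlim.liminf_eq] at h
  exact nonpos_iff_eq_zero.1 h

theorem tsum_ofReal_mul_half_pow_ne_top (C : ℝ) :
    ∑' k : ℕ, ENNReal.ofReal (C * (1 / 2) ^ k) ≠ ∞ :=
  (Summable.mul_left C summable_geometric_two).tsum_ofReal_ne_top

theorem ediam_image_le_of_norm_sub_le {E F : Type*} [NormedAddCommGroup E] [NormedSpace ℝ E]
    [NormedAddCommGroup F] [NormedSpace ℝ F] (T : E →L[ℝ] F) {s : Set E} {r : ℝ}
    (hs : ∀ x ∈ s, ∀ y ∈ s, ‖x - y‖ ≤ r) : Metric.ediam (T '' s) ≤ ENNReal.ofReal (‖T‖ * r) := by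
  refine Metric.ediam_le ?_
  rintro _ ⟨x, hx, rfl⟩ _ ⟨y, hy, rfl⟩
  rw [edist_dist, dist_eq_norm, ← map_sub]
  exact ENNReal.ofReal_le_ofReal ((T.le_opNorm _).trans
    (mul_le_mul_of_nonneg_left (hs x hx y hy) (norm_nonneg _)))

/-- The identity map from `ℝ^n` with the supremum norm to `ℝ^n` with the Euclidean norm. -/
noncomputable def supToEuclidean (n : ℕ) : (Fin n → ℝ) →L[ℝ] EuclideanSpace ℝ (Fin n) :=
  (EuclideanSpace.equiv (Fin n) ℝ).symm

/-- The size of the spikes needed to make the set `spikeSet` negligible for the gauge `g`. -/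
noncomputable def gaugeSize (n : ℕ) (g : ℝ≥0 → ℝ≥0) (e : ℝ) : ℝ :=
  g (‖supToEuclidean n‖ * (4 * e)).toNNReal

theorem tendsto_gaugeSize {g : ℝ≥0 → ℝ≥0} (hg : IsGauge g) (n : ℕ) :
    Tendsto (gaugeSize n g) (𝓝[>] 0) (𝓝 0) := by
  have hc : Continuous (gaugeSize n g) :=
    NNReal.continuous_coe.comp (hg.continuous.comp (continuous_real_toNNReal.comp (by fun_prop)))
  have h0 : gaugeSize n g 0 = 0 := by simp [gaugeSize, hg.map_zero]
  have := hc.tendsto 0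
  rw [h0] at this
  exact this.mono_left nhdsWithin_le_nhds

theorem SpikeSequence.gaugeMeasure_spikeSet {n : ℕ} {g : ℝ≥0 → ℝ≥0} (hg : IsGauge g)
    (s : SpikeSequence n (gaugeSize n g)) : gaugeMeasure g s.spikeSet = 0 := by
  set T := supToEuclidean n with hT
  have hdiam : ∀ (k : ℕ) (z : s.P k),
      Metric.ediam (T '' Metric.ball z.1.1 (2 * s.ε k)) ≤ ENNReal.ofReal (‖T‖ * (4 * s.ε k)) := by
    intro k z
    refine ediam_image_le_of_norm_sub_le T fun x hx y hy => ?_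
    rw [← dist_eq_norm]
    linarith [dist_triangle_right x y z.1.1, Metric.mem_ball.1 hx, Metric.mem_ball.1 hy]
  refine mkMetric_eq_zero_of_frequently_mem _ (ι := fun k => s.P k)
    (U := fun k z => T '' Metric.ball z.1.1 (2 * s.ε k))
    (r := fun k => ENNReal.ofReal (‖T‖ * (4 * s.ε k))) ?_ ?_ hdiam ?_ ?_
  · have h := (tendsto_nhdsWithin_iff.1 s.tendsto_ε).1
    have := ENNReal.tendsto_ofReal ((h.const_mul 4).const_mul ‖T‖)
    simpa using this
  · intro i j hij
    have := s.ε_antitone hij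
    apply ENNReal.ofReal_le_ofReal
    gcongr
  · refine ne_top_of_le_ne_top (tsum_ofReal_mul_half_pow_ne_top 1) (ENNReal.tsum_le_tsum fun k => ?_)
    calc _ ≤ ∑ z : s.P k, ENNReal.ofReal (gaugeSize n g (s.ε k)) := by
          refine Finset.sum_le_sum fun z _ => ?_
          have h1 := hdiam k z
          rw [if_neg (ne_top_of_le_ne_top ENNReal.ofReal_ne_top h1), gaugeSize,
            ENNReal.ofReal_coe_nnreal, ENNReal.coe_le_coe]
          exact hg.monotone (ENNReal.toNNReal_mono ENNReal.ofReal_ne_top h1)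
      _ = ENNReal.ofReal ((s.P k).card * gaugeSize n g (s.ε k)) := by
          rw [Finset.sum_const, nsmul_eq_mul, ENNReal.ofReal_mul (by positivity),
            ENNReal.ofReal_natCast, Finset.card_univ, Fintype.card_coe]
      _ ≤ _ := by
          rw [one_mul]
          exact ENNReal.ofReal_le_ofReal (s.card_le k)
  · intro x hx
    refine Frequently.mono hx fun k ⟨z, hz, hxz⟩ => ⟨⟨z, hz⟩, x.ofLp, ?_, rfl⟩
    rwa [Metric.mem_ball, dist_eq_norm]

/-! ### Finite Hausdorff measure of the graph. -/

section Graph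

variable {n : ℕ}

/-- The part above a ball of the graph of an affine function of the `j`-th coordinate. -/
def slantedPiece (q : Fin n → ℝ) (ε : ℝ) (j : Fin n) (b c : ℝ) :
    Set (EuclideanSpace ℝ (Fin (n + 1))) :=
  (fun x : Fin n → ℝ => consEuclidean n (x, b + c * x j)) '' Metric.closedBall q ε

theorem hausdorffMeasure_slantedPiece_le (q : Fin n → ℝ) {ε : ℝ} (j : Fin n) (b : ℝ)
    {c : ℝ} (hc : 1 ≤ |c|) :
    Measure.hausdorffMeasure (n : ℝ) (slantedPiece q ε j b c) ≤
      ENNReal.ofReal (‖consEuclidean n‖ ^ n * (|c| * (2 * ε) ^ n)) := by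
  classical
  rcases lt_or_ge ε 0 with hε | hε
  · rw [slantedPiece, Metric.closedBall_eq_empty.2 hε, image_empty, measure_empty]
    exact zero_le
  set J := consEuclidean n with hJ
  -- Stretching coordinate j by |c| turns the slope into ±1, so the piece is covered by a
  -- `‖J‖`-Lipschitz image of a box, whose Hausdorff measure in the sup norm is its volume.
  let w : Fin n → ℝ := fun i => if i = j then |c| else 1
  have hw : ∀ i, 1 ≤ w i := by
    intro i
    by_cases h : i = j <;> simp [w, h, hc]
  have hwj : w j = |c| := by simp [w]
  obtain ⟨σ, hσ, hσc⟩ : ∃ σ : ℝ, |σ| = 1 ∧ c = σ * |c| := by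
    rcases abs_choice c with h | h
    · exact ⟨1, by simp, by rw [h, one_mul]⟩
    · exact ⟨-1, by simp, by rw [h]; ring⟩
  let A : (Fin n → ℝ) → EuclideanSpace ℝ (Fin (n + 1)) :=
    fun t => J (fun i => t i / w i, b + σ * t j)
  have hA : LipschitzWith ‖J‖₊ A := by
    apply LipschitzWith.of_dist_le_mul
    intro t u
    rw [dist_eq_norm, dist_eq_norm]
    simp only [A]
    rw [← map_sub, Prod.mk_sub_mk]
    refine (J.le_opNorm _).trans ?_
    rw [coe_nnnorm]
    gcongr
    rw [Prod.norm_mk]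
    refine max_le ((pi_norm_le_iff_of_nonneg (norm_nonneg _)).2 fun i => ?_) ?_
    · rw [Pi.sub_apply, ← sub_div, norm_div, Real.norm_of_nonneg (zero_le_one.trans (hw i))]
      exact (div_le_self (norm_nonneg _) (hw i)).trans (norm_le_pi_norm (t - u) i)
    · rw [show b + σ * t j - (b + σ * u j) = σ * (t - u) j by rw [Pi.sub_apply]; ring, norm_mul,
        Real.norm_eq_abs σ, hσ, one_mul]
      exact norm_le_pi_norm (t - u) j
  have hsub : slantedPiece q ε j b c ⊆
      A '' Icc (fun i => w i * (q i - ε)) (fun i => w i * (q i + ε)) := by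
    rintro _ ⟨x, hx, rfl⟩
    have hx' : ∀ i, |x i - q i| ≤ ε := fun i => by
      rw [Metric.mem_closedBall, dist_eq_norm] at hx
      exact (norm_le_pi_norm (x - q) i).trans hx
    refine ⟨fun i => w i * x i, ⟨fun i => ?_, fun i => ?_⟩, ?_⟩
    · have := abs_le.1 (hx' i)
      exact mul_le_mul_of_nonneg_left (by linarith) (zero_le_one.trans (hw i))
    · have := abs_le.1 (hx' i)
      exact mul_le_mul_of_nonneg_left (by linarith) (zero_le_one.trans (hw i))
    · simp only [A]
      congr 2
      · funext i
        exact mul_div_cancel_left₀ _ (zero_lt_one.trans_le (hw i)).ne'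
      · rw [hwj, ← mul_assoc, ← hσc]
  have hvol : Measure.hausdorffMeasure (n : ℝ)
      (Icc (fun i => w i * (q i - ε)) (fun i => w i * (q i + ε))) =
      ENNReal.ofReal (|c| * (2 * ε) ^ n) := by
    have := hausdorffMeasure_pi_real (ι := Fin n)
    rw [Fintype.card_fin] at this
    rw [this, Real.volume_Icc_pi, ← ENNReal.ofReal_prod_of_nonneg]
    · congr 1
      calc ∏ i, (w i * (q i + ε) - w i * (q i - ε)) = ∏ i, w i * (2 * ε) := by
            congr 1; funext i; ring
        _ = |c| * (2 * ε) ^ n := by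
            rw [Finset.prod_mul_distrib, Finset.prod_const, Finset.card_univ, Fintype.card_fin,
              Finset.prod_ite_eq' Finset.univ j]
            simp
    · intro i _
      nlinarith [hw i]
  refine (measure_mono hsub).trans ((hA.hausdorffMeasure_image_le n.cast_nonneg _).trans ?_)
  rw [hvol, ENNReal.ofReal_mul (p := ‖J‖ ^ n) (by positivity), ENNReal.rpow_natCast,
    ENNReal.ofReal_pow (norm_nonneg _), ← enorm_eq_nnnorm, ofReal_norm]

theorem exists_norm_eq_abs_apply (hn : 0 < n) (v : Fin n → ℝ) : ∃ j, ‖v‖ = |v j| := by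
  by_contra! h
  have h' : ∀ j, ‖v j‖ < ‖v‖ := fun j => lt_of_le_of_ne (norm_le_pi_norm v j) (h j).symm
  have hpos : 0 < ‖v‖ := (norm_nonneg _).trans_lt (h' ⟨0, hn⟩)
  exact lt_irrefl _ ((pi_norm_lt_iff hpos).2 h')

end Graph

namespace SpikeSequence

variable {n : ℕ}

/-- The slanted sides of the spikes added at step `k`. -/
def sides {ψ : ℝ → ℝ} (s : SpikeSequence n ψ) (k : ℕ) : Set (EuclideanSpace ℝ (Fin (n + 1))) :=
  ⋃ i : s.P k × Fin n × ({1, -3} : Finset ℝ) × ({1, -1} : Finset ℝ),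
    slantedPiece i.1.1.1 (s.ε k) i.2.1
      (i.1.1.2 + i.2.2.1.1 * s.η k - i.2.2.2.1 * (4 * s.η k / s.ε k) * i.1.1.1 i.2.1)
      (i.2.2.2.1 * (4 * s.η k / s.ε k))

theorem hausdorffMeasure_sides_le (s : SpikeSequence n fun e => e ^ (n - 1)) (hn : 1 < n)
    (k : ℕ) : Measure.hausdorffMeasure (n : ℝ) (s.sides k) ≤
      ENNReal.ofReal ((n * 4) * ‖consEuclidean n‖ ^ n * 2 ^ n * 4 * (1 / 2) ^ k) := by
  have hε := s.ε_pos k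
  have hη := s.η_pos k
  set K := 4 * s.η k / s.ε k with hK
  have hK1 : 1 ≤ K := by
    rw [hK, le_div_iff₀ hε]; linarith [s.ε_le_η k]
  refine (measure_iUnion_le _).trans ?_
  rw [tsum_fintype]
  calc _ ≤ ∑ i : s.P k × Fin n × ({1, -3} : Finset ℝ) × ({1, -1} : Finset ℝ),
        ENNReal.ofReal (‖consEuclidean n‖ ^ n * (K * (2 * s.ε k) ^ n)) := by
        refine Finset.sum_le_sum fun i _ => ?_
        have hi : |i.2.2.2.1 * K| = K := by
          have h1 := i.2.2.2.2
          rw [Finset.mem_insert, Finset.mem_singleton] at h1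
          rw [abs_mul, abs_of_pos (zero_lt_one.trans_le hK1)]
          rcases h1 with h | h <;> simp [h]
        have := hausdorffMeasure_slantedPiece_le i.1.1.1 (ε := s.ε k) i.2.1
          (i.1.1.2 + i.2.2.1.1 * s.η k - i.2.2.2.1 * K * i.1.1.1 i.2.1) (hK1.trans hi.ge)
        rwa [hi] at this
    _ = ENNReal.ofReal ((s.P k).card * (n * 4) *
          (‖consEuclidean n‖ ^ n * (K * (2 * s.ε k) ^ n))) := by
        have h1 : ({1, -3} : Finset ℝ).card = 2 := Finset.card_pair (by norm_num)
        have h2 : ({1, -1} : Finset ℝ).card = 2 := Finset.card_pair (by norm_num)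
        rw [Finset.sum_const, nsmul_eq_mul, Finset.card_univ]
        simp only [Fintype.card_prod, Fintype.card_coe, Fintype.card_fin, h1, h2]
        rw [← ENNReal.ofReal_natCast, ← ENNReal.ofReal_mul (by positivity)]
        push_cast
        ring_nf
    _ ≤ _ := by
        apply ENNReal.ofReal_le_ofReal
        have e : s.ε k ^ n = s.ε k ^ (n - 1) * s.ε k := by
          rw [← pow_succ, Nat.sub_add_cancel hn.le]
        have e2 : K * s.ε k ^ n = 4 * s.η k * s.ε k ^ (n - 1) := by
          rw [e, hK]; field_simp
        calc ((s.P k).card : ℝ) * (n * 4) * (‖consEuclidean n‖ ^ n * (K * (2 * s.ε k) ^ n))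
            = (n * 4) * ‖consEuclidean n‖ ^ n * 2 ^ n * 4 *
                ((s.P k).card * s.ε k ^ (n - 1)) * s.η k := by
              rw [mul_pow, mul_left_comm K, e2]; ring
          _ ≤ (n * 4) * ‖consEuclidean n‖ ^ n * 2 ^ n * 4 * ((1 / 2) ^ k) * 1 := by
              gcongr
              · exact s.card_le k
              · exact s.η_le_one k
          _ = _ := by ring

/-- The points of the graph of the limit that lie above infinitely many spikes. -/
def spikyPart {ψ : ℝ → ℝ} (s : SpikeSequence n ψ) : Set (EuclideanSpace ℝ (Fin (n + 1))) :=
  graphMap s.lim '' {x | ∃ᶠ k in atTop, ∃ z ∈ s.P k, ‖x.ofLp - z.1‖ < s.ε k}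

/-- The column above a spike is cut into about 4η/ε boxes of size ε, costing order η ε^(n-1) + ε^n
per spike, hence at most a multiple of ε^(n-1). -/
theorem hausdorffMeasure_spikyPart (s : SpikeSequence n fun e => e ^ (n - 1)) (hn : 1 < n) :
    Measure.hausdorffMeasure (n : ℝ) s.spikyPart = 0 := by
  set J := consEuclidean n with hJ
  -- The column is [b - 2η, b + 2η]: step k stays within η of b and later steps add at most ε ≤ η.
  let N : ℕ → ℕ := fun k => ⌊4 * s.η k / s.ε k⌋₊ + 1
  let box : ∀ k, s.P k × Fin (N k) → Set ((Fin n → ℝ) × ℝ) := fun k i =>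
    {w | ‖w.1 - i.1.1.1‖ ≤ s.ε k ∧
      w.2 ∈ Icc (i.1.1.2 - 2 * s.η k + i.2 * s.ε k) (i.1.1.2 - 2 * s.η k + (i.2 + 1) * s.ε k)}
  have hdiam : ∀ k i, Metric.ediam (J '' box k i) ≤ ENNReal.ofReal (‖J‖ * (2 * s.ε k)) := by
    intro k i
    have hε := s.ε_pos k
    refine ediam_image_le_of_norm_sub_le J fun x hx y hy => ?_
    rw [Prod.norm_def]
    refine max_le ?_ ?_
    · have h := norm_sub_le_norm_sub_add_norm_sub x.1 i.1.1.1 y.1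
      rw [norm_sub_rev i.1.1.1 y.1] at h
      rw [Prod.fst_sub]
      linarith [hx.1, hy.1]
    · rw [Prod.snd_sub, Real.norm_eq_abs, abs_le]
      constructor <;> linarith [hx.2.1, hx.2.2, hy.2.1, hy.2.2]
  refine mkMetric_eq_zero_of_frequently_mem _ (ι := fun k => s.P k × Fin (N k))
    (U := fun k i => J '' box k i)
    (r := fun k => ENNReal.ofReal (‖J‖ * (2 * s.ε k))) ?_ ?_ hdiam ?_ ?_
  · have h := (tendsto_nhdsWithin_iff.1 s.tendsto_ε).1
    have := ENNReal.tendsto_ofReal ((h.const_mul 2).const_mul ‖J‖)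
    simpa using this
  · intro i j hij
    have := s.ε_antitone hij
    apply ENNReal.ofReal_le_ofReal
    gcongr
  · refine ne_top_of_le_ne_top (tsum_ofReal_mul_half_pow_ne_top (5 * ‖J‖ ^ n * 2 ^ n))
      (ENNReal.tsum_le_tsum fun k => ?_)
    have hε := s.ε_pos k
    have hη := s.η_pos k
    calc _ ≤ ∑ i : s.P k × Fin (N k), ENNReal.ofReal ((‖J‖ * (2 * s.ε k)) ^ n) := by
          refine Finset.sum_le_sum fun i _ => ?_
          rw [ENNReal.rpow_natCast, ENNReal.ofReal_pow (by positivity)]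
          gcongr
          exact hdiam k i
      _ = ENNReal.ofReal ((s.P k).card * N k * (‖J‖ * (2 * s.ε k)) ^ n) := by
          rw [Finset.sum_const, nsmul_eq_mul, Finset.card_univ, Fintype.card_prod, Fintype.card_coe,
            Fintype.card_fin, ← ENNReal.ofReal_natCast, ← ENNReal.ofReal_mul (by positivity)]
          push_cast
          rfl
      _ ≤ _ := by
          apply ENNReal.ofReal_le_ofReal
          have hN : (N k : ℝ) * s.ε k ≤ 5 := by
            have h1 : (⌊4 * s.η k / s.ε k⌋₊ : ℝ) ≤ 4 * s.η k / s.ε k :=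
              Nat.floor_le (by positivity)
            rw [le_div_iff₀ hε] at h1
            simp only [N]
            push_cast
            linarith [s.ε_le_η k, s.η_le_one k]
          have e : s.ε k ^ n = s.ε k ^ (n - 1) * s.ε k := by
            rw [← pow_succ, Nat.sub_add_cancel hn.le]
          calc ((s.P k).card : ℝ) * N k * (‖J‖ * (2 * s.ε k)) ^ n
              = (N k * s.ε k) * ‖J‖ ^ n * 2 ^ n * ((s.P k).card * s.ε k ^ (n - 1)) := by
                rw [mul_pow, mul_pow, e]; ring
            _ ≤ 5 * ‖J‖ ^ n * 2 ^ n * (1 / 2) ^ k := by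
                gcongr
                exact s.card_le k
  · rintro _ ⟨x, hx, rfl⟩
    refine Frequently.mono hx fun k ⟨z, hz, hxz⟩ => ?_
    have hε := s.ε_pos k
    have h1 := abs_le.1 ((s.isSpiking k).near x.ofLp z hz hxz)
    have h2 := abs_le.1 (s.abs_lim_sub_le k x.ofLp)
    have h3 := s.ε_le_η k
    set v := (s.lim x.ofLp - z.2 + 2 * s.η k) / s.ε k with hv
    have hv0 : 0 ≤ v := div_nonneg (by linarith [h1.1, h2.1]) hε.le
    have hv1 : v ≤ 4 * s.η k / s.ε k := by
      rw [hv]; gcongr; linarith [h1.2, h2.2]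
    have hvε : v * s.ε k = s.lim x.ofLp - z.2 + 2 * s.η k := by
      rw [hv]; field_simp
    have hf1 : (⌊v⌋₊ : ℝ) * s.ε k ≤ v * s.ε k := by gcongr; exact Nat.floor_le hv0
    have hf2 : v * s.ε k ≤ (⌊v⌋₊ + 1) * s.ε k := by gcongr; exact (Nat.lt_floor_add_one v).le
    refine ⟨(⟨z, hz⟩, ⟨⌊v⌋₊, Nat.lt_succ_of_le (Nat.floor_le_floor hv1)⟩),
      (x.ofLp, s.lim x.ofLp), ⟨hxz.le, ?_, ?_⟩, rfl⟩
    · simp only; linarith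
    · simp only; linarith

theorem graph_subset {ψ : ℝ → ℝ} (s : SpikeSequence n ψ) (hn : 0 < n) :
    graphMap s.lim '' unitCube n ⊆
      ((fun x : Fin n → ℝ => consEuclidean n (x, 0)) '' Icc 0 1 ∪ ⋃ k, s.sides k) ∪
        s.spikyPart := by
  rintro _ ⟨x, hx, rfl⟩
  by_cases hinf : ∃ᶠ k in atTop, ∃ z ∈ s.P k, ‖x.ofLp - z.1‖ < s.ε k
  · exact Or.inr ⟨x, hinf, rfl⟩
  left
  rw [not_frequently, eventually_atTop] at hinf
  obtain ⟨k₀, hk₀⟩ := hinf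
  have hconst : ∀ k ≥ k₀, s.F k x.ofLp = s.F k₀ x.ofLp := by
    intro k hk
    induction k, hk using Nat.le_induction with
    | base => rfl
    | succ k hk ih =>
      rw [← ih]
      apply (s.isSpiking k).eq_of_far
      intro z hz
      by_contra! h
      exact hk₀ k hk ⟨z, hz, h⟩
  have hlim : s.lim x.ofLp = s.F k₀ x.ofLp :=
    tendsto_nhds_unique (s.tendsto_lim x.ofLp) (tendsto_const_nhds.congr'
      (eventually_atTop.2 ⟨k₀, fun k hk => (hconst (k + 1) (hk.trans k.le_succ)).symm⟩))
  clear hconst hk₀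
  -- Going back through the steps, the value either is unchanged, down to `F 0 = 0`, or was put on a
  -- cone; in the sup norm the cone is affine in a coordinate of maximal size.
  induction k₀ with
  | zero =>
    left
    refine ⟨x.ofLp, mem_unitCube_iff.1 hx, ?_⟩
    rw [graphMap, hlim, s.F_zero]
    rfl
  | succ k ih =>
    rcases (s.isSpiking k).cases x.ofLp with h | ⟨z, hz, hxz, h⟩
    · exact ih (hlim.trans h)
    · right
      rw [← hlim] at h
      obtain ⟨j, hj⟩ := exists_norm_eq_abs_apply hn (x.ofLp - z.1)
      rw [hj, Pi.sub_apply] at h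
      have hmem : ∀ σ ∈ ({1, -3} : Finset ℝ), ∀ τ ∈ ({1, -1} : Finset ℝ),
          s.lim x.ofLp = z.2 + σ * s.η k + τ * (4 * s.η k / s.ε k) * (x.ofLp j - z.1 j) →
          graphMap s.lim x ∈ ⋃ k, s.sides k := by
        intro σ hσ τ hτ hx
        refine mem_iUnion.2 ⟨k, mem_iUnion.2 ⟨(⟨z, hz⟩, j, ⟨σ, hσ⟩, ⟨τ, hτ⟩), x.ofLp, ?_, ?_⟩⟩
        · rwa [Metric.mem_closedBall, dist_eq_norm]
        · simp only [graphMap]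
          rw [hx]
          congr 2
          ring
      rcases abs_choice (x.ofLp j - z.1 j) with ha | ha <;> rw [ha] at h <;> rcases h with h | h
      · exact hmem 1 (by simp) (-1) (by simp) (by linarith)
      · exact hmem (-3) (by simp) 1 (by simp) (by linarith)
      · exact hmem 1 (by simp) 1 (by simp) (by linarith)
      · exact hmem (-3) (by simp) (-1) (by simp) (by linarith)

theorem hausdorffMeasure_graph_lt_top (s : SpikeSequence n fun e => e ^ (n - 1)) (hn : 1 < n) :
    Measure.hausdorffMeasure (n : ℝ) (graphMap s.lim '' unitCube n) < ∞ := by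
  refine (measure_mono (s.graph_subset (zero_lt_one.trans hn))).trans_lt ?_
  refine (measure_union_le _ _).trans_lt ?_
  rw [s.hausdorffMeasure_spikyPart hn, add_zero]
  refine (measure_union_le _ _).trans_lt (ENNReal.add_lt_top.2 ⟨?_, ?_⟩)
  · have hlip := ((consEuclidean n).comp (ContinuousLinearMap.inl ℝ (Fin n → ℝ) ℝ)).lipschitz
    refine (hlip.hausdorffMeasure_image_le n.cast_nonneg (Icc 0 1)).trans_lt ?_
    refine ENNReal.mul_lt_top (ENNReal.rpow_lt_top_of_nonneg n.cast_nonneg ENNReal.coe_ne_top) ?_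
    have := hausdorffMeasure_pi_real (ι := Fin n)
    rw [Fintype.card_fin] at this
    rw [this]
    exact isCompact_Icc.measure_lt_top
  · refine (measure_iUnion_le _).trans_lt ?_
    exact (ENNReal.tsum_le_tsum (s.hausdorffMeasure_sides_le hn)).trans_lt
      (tsum_ofReal_mul_half_pow_ne_top _).lt_top

end SpikeSequence

theorem proposition4p1 :
    (∀ n : ℕ, 1 < n →
      ∃ S : Set (EuclideanSpace ℝ (Fin (n + 1))),
        Nonempty (unitCube n ≃ₜ S) ∧
        Measure.hausdorffMeasure (n : ℝ) S < ∞ ∧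
        ∀ x ∈ S, ¬ HasTangentPlaneAt n S x) ∧
    (∀ n : ℕ, 1 ≤ n → ∀ g : ℝ≥0 → ℝ≥0, IsGauge g →
      ∃ (S : Set (EuclideanSpace ℝ (Fin (n + 1))))
        (h : EuclideanSpace ℝ (Fin n) → EuclideanSpace ℝ (Fin (n + 1))),
        (∃ e : unitCube n ≃ₜ S,
          ∀ x : unitCube n, (e x : EuclideanSpace ℝ (Fin (n + 1))) = h x) ∧
        (∃ N : Set (EuclideanSpace ℝ (Fin n)),
          gaugeMeasure g N = 0 ∧
          ∀ x : unitCube n, (x : EuclideanSpace ℝ (Fin n)) ∉ N →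
            lowerScaledOscillation (fun y : unitCube n => h y) x < ∞) ∧
        ∀ x ∈ unitCube n, ¬ DifferentiableWithinAt ℝ h (unitCube n) x) := by
  constructor
  · intro n hn
    have hψ : Tendsto (fun e : ℝ => e ^ (n - 1)) (𝓝[>] 0) (𝓝 0) := by
      have := (continuous_pow (M := ℝ) (n - 1)).tendsto 0
      rw [zero_pow (by omega)] at this
      exact this.mono_left nhdsWithin_le_nhds
    obtain ⟨s⟩ := nonempty_spikeSequence (zero_lt_one.trans hn) hψ
    obtain ⟨e, -⟩ := exists_homeomorph_graph s.continuous_lim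
    exact ⟨_, ⟨e⟩, s.hausdorffMeasure_graph_lt_top hn, fun x hx => s.not_hasTangentPlaneAt hx⟩
  · intro n hn g hg
    obtain ⟨s⟩ := nonempty_spikeSequence hn (tendsto_gaugeSize hg n)
    exact ⟨_, graphMap s.lim, exists_homeomorph_graph s.continuous_lim,
      ⟨s.spikeSet, s.gaugeMeasure_spikeSet hg, fun x hx => s.lowerScaledOscillation_lt_top hx⟩,
      fun x hx => s.not_differentiableWithinAt hx⟩
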